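/- Let $m<n$ be nonnegative integers and let $[\underline{b_i},\overline{b_i}]$ ($0\le i\le m$) and $[\underline{a_i},\overline{a_i}]$ ($0\le i\le n$) be nonempty compact real intervals with $0\notin[\underline{a_n},\overline{a_n}]$. Put $$K_g=\Big\{\sum_{i=0}^m b_is^i : b_i\in[\underline{b_i},\overline{b_i}]\Big\},\qquad K_f=\Big\{\sum_{i=0}^n a_is^i : a_i\in[\underline{a_i},\overline{a_i}]\Big\}.$$ Define $$\alpha_f^{(1)}(s^2)=\underline{a_0}+\overline{a_2}s^2+\underline{a_4}s^4+\overline{a_6}s^6+\cdots,\qquad \alpha_f^{(2)}(s^2)=\overline{a_0}+\underline{a_2}s^2+\overline{a_4}s^4+\underline{a_6}s^6+\cdots,$$ $$\beta_f^{(1)}(s^2)=\underline{a_1}+\overline{a_3}s^2+\underline{a_5}s^4+\overline{a_7}s^6+\cdots,\qquad \beta_f^{(2)}(s^2)=\overline{a_1}+\underline{a_3}s^2+\overline{a_5}s^4+\underline{a_7}s^6+\cdots$$ (coefficient indices at most $n$), and let $f_{ij}(s)=\alpha_f^{(i)}(s^2)+s\,\beta_f^{(j)}(s^2)$, $i,j\in\{1,2\}$,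 be the four Kharitonov vertices of $K_f$; define the Kharitonov vertices $g_{ij}$ of $K_g$ in the same way from the intervals $[\underline{b_i},\overline{b_i}]$ (coefficient indices at most $m$). A polynomial is called Hurwitz if all of its complex roots have negative real part (so the zero polynomial is not Hurwitz). For polynomials $p,q$ with $q$ Hurwitz and $\deg p\le\deg q$, let $\left\|\frac pq\right\|_\infty=\sup_{\omega\in\mathbb R}\left|\frac{p(j\omega)}{q(j\omega)}\right|$, where $j$ is the imaginary unit. Suppose that $g_{ij}+f_{ij}$ is Hurwitz for all $i,j\in\{1,2\}$. Then for all $g\in K_g$ and $f\in K_f$ the polynomial $f+g$ is Hurwitz, $\deg f\le\deg(f+g)$, and $\left\|\frac{f}{f+g}\right\|_\infty$ is finite. Moreover, both of the following maxima exist, and $$\max\left\{\left\|\frac{f}{f+g}\right\|_\infty : g\in K_g,\ f\in K_f\right\}=\max\left\{\left\|\frac{f_{i_2j_2}}{f_{i_2j_2}+g_{i_1j_1}}\right\|_\infty : (i_1j_1i_2j_2)\in T\right\},$$ where $$T=\{(1111),(1212),(2222),(2121),(1112),(1222),(2221),(2111),(1211),(2212),(2122),(1121)\}.$$ -/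

import Mathlib

open Polynomial

noncomputable section

/-- The real interval polynomial family `{∑_{i=0}^d c_i s^i | c_i ∈ [lo_i, hi_i], i = 0, …, d}`.
Only the values `lo i`, `hi i` with `i ≤ d` matter. -/
def intervalFamily (d : ℕ) (lo hi : ℕ → ℝ) : Set ℝ[X] :=
  {p | ∃ c : ℕ → ℝ, (∀ i ≤ d, c i ∈ Set.Icc (lo i) (hi i)) ∧
    p = ∑ i ∈ Finset.range (d + 1), C (c i) * X ^ i}

/-- The alternating choice of interval endpoints. Type `i = 1` is the pattern lower, upper, lower,
upper, … in `k = 0, 1, 2, …`; type `i = 2` is the pattern upper, lower, upper, lower, … .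
Here `l` is the coefficient index. -/
def vertexCoeff (lo hi : ℕ → ℝ) (i k l : ℕ) : ℝ :=
  if i = 1 then (if Even k then lo l else hi l) else (if Even k then hi l else lo l)

/-- `α^{(i)}(t)` for `i = 1, 2`, as a polynomial in `t = s²`: the coefficient of `t^k` is an
endpoint of the interval of index `2k ≤ d`. -/
def vertexEven (d : ℕ) (lo hi : ℕ → ℝ) (i : ℕ) : ℝ[X] :=
  ∑ k ∈ Finset.range (d / 2 + 1), C (vertexCoeff lo hi i k (2 * k)) * X ^ k

/-- `β^{(j)}(t)` for `j = 1, 2`, as a polynomial in `t = s²`: the coefficient of `t^k` is an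
endpoint of the interval of index `2k + 1 ≤ d`. -/
def vertexOdd (d : ℕ) (lo hi : ℕ → ℝ) (j : ℕ) : ℝ[X] :=
  ∑ k ∈ Finset.range ((d + 1) / 2), C (vertexCoeff lo hi j k (2 * k + 1)) * X ^ k

/-- The Kharitonov vertex polynomial `α^{(i)}(s²) + s β^{(j)}(s²)`, for `i, j ∈ {1, 2}`. -/
def kharitonovVertex (d : ℕ) (lo hi : ℕ → ℝ) (i j : ℕ) : ℝ[X] :=
  (vertexEven d lo hi i).comp (X ^ 2) + X * (vertexOdd d lo hi j).comp (X ^ 2)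

/-- Hurwitz stability: all complex roots lie in the open left half plane. The zero polynomial is
not Hurwitz. -/
def IsHurwitz (p : ℝ[X]) : Prop :=
  ∀ z : ℂ, aeval z p = 0 → z.re < 0

/-- `p / q` is a proper stable rational function. -/
def IsProperStable (p q : ℝ[X]) : Prop :=
  IsHurwitz q ∧ p.degree ≤ q.degree

/-- The set of the moduli of `p(jω) / q(jω)` for real `ω`. -/
def freqGains (p q : ℝ[X]) : Set ℝ :=
  Set.range fun ω : ℝ => ‖aeval ((ω : ℂ) * Complex.I) p / aeval ((ω : ℂ) * Complex.I) q‖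

/-- The `H∞` norm of the proper stable rational function `p / q`. -/
def hInfNorm (p q : ℝ[X]) : ℝ :=
  sSup (freqGains p q)

/-- The twelve index quadruples `(i₁, j₁, i₂, j₂)`. -/
def twelveIndices : Set (ℕ × ℕ × ℕ × ℕ) :=
  {(1, 1, 1, 1), (1, 2, 1, 2), (2, 2, 2, 2), (2, 1, 2, 1),
   (1, 1, 1, 2), (1, 2, 2, 2), (2, 2, 2, 1), (2, 1, 1, 1),
   (1, 2, 1, 1), (2, 2, 1, 2), (2, 1, 2, 2), (1, 1, 2, 1)}

end

/-! The argument turns a gain bound into zero exclusion for a complex multiple of `f`. Let `K` bound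
the gains of the twelve vertex systems; `K ≥ 1`, because `f / (f + g)` tends to 1 at infinite
frequency. If `|f| > K |f + g|` at some `iω` with `ω ≥ 0`, put `ζ = -(f + g) / f` there and `z = 1 +
ζ`. Then `z f + g` vanishes at `iω`, while `|ζ| K < 1`, so `|ζ| < 1` and `Re z > 0`. By a small gain
homotopy every twelve-vertex combination `z F + G = (F + G) + ζ F` is Hurwitz. It remains to see
that this forbids a zero of `z f + g` at `iω` (`combinedValue_ne_zero`).

At `iω`, the values of `f` and `g` lie in rectangles spanned by Kharitonov vertices, so the values
of `z f + g` lie in a compact convex set, the image of a box. It omits 0 at `ω = 0`. If it contains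
0 later, then by connectedness there is a frequency at which it contains 0 and also lies in a closed
half plane `Re (d w) ≥ 0`. Write `d z = a + i b` and `d = p + i q`. Then `a p + b q = |d|² Re z >
0`, so `a p > 0` or `b q > 0`. Accordingly the minimizing vertices of the two rectangles share their
real or their imaginary index, which is exactly the condition defining the twelve quadruples. The
two vertex combinations bounding the supporting face have equal `Re (d ·)` at all frequencies, but
sit weakly on opposite sides of 0. This contradicts the strict increase of the phase of Hurwitz
polynomials (`not_opposite`).

For `z = 1` one has `a = p` and `b = q`, so all indices agree and only the four assumed vertices are
needed. The same lemma thus gives Kharitonov's theorem for `f + g`. -/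

/-! ### Complex Hurwitz polynomials: phase, growth, homotopy -/

/-- Hurwitz stability of a complex polynomial. -/
def IsHurwitzComplex (p : ℂ[X]) : Prop :=
  ∀ z : ℂ, p.eval z = 0 → z.re < 0

theorem isHurwitz_iff_map (p : ℝ[X]) :
    IsHurwitz p ↔ IsHurwitzComplex (p.map (algebraMap ℝ ℂ)) := by
  simp [IsHurwitz, IsHurwitzComplex, eval_map_algebraMap]

namespace IsHurwitzComplex

variable {p : ℂ[X]}

theorem eval_ne_zero (hp : IsHurwitzComplex p) {z : ℂ} (hz : 0 ≤ z.re) : p.eval z ≠ 0 :=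
  fun h => (hp z h).not_ge hz

theorem ne_zero (hp : IsHurwitzComplex p) : p ≠ 0 := by
  rintro rfl
  exact hp.eval_ne_zero (z := 0) le_rfl (by simp)

theorem re_lt_zero_of_mem_roots (hp : IsHurwitzComplex p) {r : ℂ} (hr : r ∈ p.roots) :
    r.re < 0 :=
  hp r (by simpa [hp.ne_zero] using hr)

/-- The argument of a nonconstant Hurwitz polynomial strictly increases along the imaginary
axis. -/
theorem re_conj_mul_eval_derivative_pos (hp : IsHurwitzComplex p) (hd : 0 < p.natDegree) {z : ℂ}
    (hz : 0 ≤ z.re) :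
    0 < ((starRingEnd ℂ) (p.eval z) * p.derivative.eval z).re := by
  have hne := hp.eval_ne_zero hz
  have hsplit : p.Splits := IsAlgClosed.splits p
  have hlog := hsplit.eval_derivative_div_eval_of_ne_zero hne
  -- The logarithmic derivative is the sum of `1 / (z - r)` over the roots, and each term has
  -- positive real part.
  have hsum : ∀ s : Multiset ℂ, s ≠ 0 → (∀ r ∈ s, r.re < 0) →
      0 < (s.map fun r => 1 / (z - r)).sum.re := by
    intro s
    induction s using Multiset.induction with
    | empty => simp
    | cons r s ih =>
      intro _ hs
      have hr : r.re < 0 := hs r (by simp)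
      have h1 : 0 < (1 / (z - r)).re := by
        have hre : 0 < (z - r).re := by simp; linarith
        rw [one_div, Complex.inv_re]
        refine div_pos hre (Complex.normSq_pos.2 ?_)
        intro h
        simp [h] at hre
      simp only [Multiset.map_cons, Multiset.sum_cons, Complex.add_re]
      rcases eq_or_ne s 0 with rfl | hs0
      · simpa using h1
      · exact add_pos h1 (ih hs0 fun x hx => hs x (Multiset.mem_cons_of_mem hx))
  have hroots : p.roots ≠ 0 := by
    intro h
    have := hsplit.natDegree_eq_card_roots
    simp [h] at this
    omega
  have hpos := hsum p.roots hroots fun r hr => hp.re_lt_zero_of_mem_roots hr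
  rw [← hlog] at hpos
  have : (starRingEnd ℂ) (p.eval z) * p.derivative.eval z
      = (Complex.normSq (p.eval z) : ℂ) * (p.derivative.eval z / p.eval z) := by
    rw [← Complex.mul_conj]
    field_simp
  rw [this, Complex.re_ofReal_mul]
  exact mul_pos (Complex.normSq_pos.2 hne) hpos

/-- Each root factor satisfies `|z - r| ≥ Re z`. Unlike stability itself, this bound is a closed
condition on the coefficients. -/
theorem norm_coeff_mul_re_pow_le (hp : IsHurwitzComplex p) {z : ℂ} (hz : 0 ≤ z.re) :
    ‖p.leadingCoeff‖ * z.re ^ p.natDegree ≤ ‖p.eval z‖ := by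
  have hsplit : p.Splits := IsAlgClosed.splits p
  have hprod : ∀ s : Multiset ℂ, (∀ r ∈ s, r.re < 0) →
      z.re ^ s.card ≤ ‖(s.map fun r => z - r).prod‖ := by
    intro s
    induction s using Multiset.induction with
    | empty => simp
    | cons r s ih =>
      intro hs
      have hr : r.re < 0 := hs r (by simp)
      have h1 : z.re ≤ ‖z - r‖ := by
        refine le_trans ?_ (Complex.re_le_norm _)
        simp; linarith
      have h2 := ih fun x hx => hs x (Multiset.mem_cons_of_mem hx)
      simp only [Multiset.map_cons, Multiset.prod_cons, Multiset.card_cons, norm_mul, pow_succ']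
      gcongr
  rw [hsplit.eval_eq_prod_roots, norm_mul, hsplit.natDegree_eq_card_roots]
  gcongr
  exact hprod _ fun r hr => hp.re_lt_zero_of_mem_roots hr

theorem exists_pow_le_norm_eval (hp : IsHurwitzComplex p) :
    ∃ C : ℝ, 0 < C ∧ ∀ z : ℂ, 0 ≤ z.re → (1 + ‖z‖) ^ p.natDegree ≤ C * ‖p.eval z‖ := by
  have hsplit : p.Splits := IsAlgClosed.splits p
  have hprod : ∀ s : Multiset ℂ, (∀ r ∈ s, r.re < 0) →
      ∃ C : ℝ, 0 < C ∧ ∀ z : ℂ, 0 ≤ z.re →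
        (1 + ‖z‖) ^ s.card ≤ C * ‖(s.map fun r => z - r).prod‖ := by
    intro s
    induction s using Multiset.induction with
    | empty => intro _; exact ⟨1, one_pos, by simp⟩
    | cons r s ih =>
      intro hs
      have hr : r.re < 0 := hs r (by simp)
      obtain ⟨C, hC, h⟩ := ih fun x hx => hs x (Multiset.mem_cons_of_mem hx)
      have hE : 0 < (1 + ‖r‖) / (-r.re) + 1 := by
        have : 0 < (1 + ‖r‖) / (-r.re) := div_pos (by positivity) (by linarith)
        linarith
      refine ⟨((1 + ‖r‖) / (-r.re) + 1) * C, by positivity, fun z hz => ?_⟩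
      -- The constant comes from `1 + |z| ≤ (1 + |r|) + |z - r|` and `-Re r ≤ |z - r|`.
      have h1 : 1 + ‖z‖ ≤ ((1 + ‖r‖) / (-r.re) + 1) * ‖z - r‖ := by
        have h2 : -r.re ≤ ‖z - r‖ := by
          refine le_trans ?_ (Complex.re_le_norm _)
          simp; linarith
        have h3 : ‖z‖ ≤ ‖r‖ + ‖z - r‖ := norm_le_insert' z r
        have h4 : 1 + ‖r‖ ≤ (1 + ‖r‖) / (-r.re) * ‖z - r‖ := by
          rw [div_mul_eq_mul_div, le_div_iff₀ (by linarith)]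
          gcongr
        linarith
      simp only [Multiset.map_cons, Multiset.prod_cons, Multiset.card_cons, norm_mul, pow_succ']
      calc (1 + ‖z‖) * (1 + ‖z‖) ^ s.card
          ≤ (((1 + ‖r‖) / (-r.re) + 1) * ‖z - r‖)
            * (C * ‖(s.map fun r => z - r).prod‖) := by
            gcongr
            exact h z hz
        _ = _ := by ring
  obtain ⟨C, hC, h⟩ := hprod p.roots fun r hr => hp.re_lt_zero_of_mem_roots hr
  have hl : 0 < ‖p.leadingCoeff‖ := norm_pos_iff.2 (leadingCoeff_ne_zero.2 hp.ne_zero)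
  refine ⟨C / ‖p.leadingCoeff‖, by positivity, fun z hz => ?_⟩
  rw [hsplit.eval_eq_prod_roots, norm_mul, hsplit.natDegree_eq_card_roots]
  refine (h z hz).trans_eq ?_
  field_simp

/-- A Hurwitz polynomial dominates every polynomial of at most the same degree on the closed right
half plane. -/
theorem exists_norm_eval_le (hp : IsHurwitzComplex p) {q : ℂ[X]}
    (hq : q.natDegree ≤ p.natDegree) :
    ∃ C : ℝ, 0 < C ∧ ∀ z : ℂ, 0 ≤ z.re → ‖q.eval z‖ ≤ C * ‖p.eval z‖ := by
  obtain ⟨C, hC, h⟩ := hp.exists_pow_le_norm_eval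
  refine ⟨(∑ i ∈ Finset.range (q.natDegree + 1), ‖q.coeff i‖ + 1) * C, by positivity,
    fun z hz => ?_⟩
  have h1 : ‖q.eval z‖
      ≤ (∑ i ∈ Finset.range (q.natDegree + 1), ‖q.coeff i‖) * (1 + ‖z‖) ^ p.natDegree := by
    rw [eval_eq_sum_range, Finset.sum_mul]
    refine (norm_sum_le _ _).trans (Finset.sum_le_sum fun i hi => ?_)
    rw [norm_mul, norm_pow]
    gcongr
    calc ‖z‖ ^ i ≤ (1 + ‖z‖) ^ i := by gcongr; linarith
      _ ≤ (1 + ‖z‖) ^ p.natDegree := by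
        refine pow_le_pow_right₀ (by linarith [norm_nonneg z]) ?_
        have := Finset.mem_range.1 hi
        omega
  calc ‖q.eval z‖
      ≤ (∑ i ∈ Finset.range (q.natDegree + 1), ‖q.coeff i‖ + 1) * (1 + ‖z‖) ^ p.natDegree :=
        h1.trans (by gcongr; linarith)
    _ ≤ (∑ i ∈ Finset.range (q.natDegree + 1), ‖q.coeff i‖ + 1) * (C * ‖p.eval z‖) := by
        gcongr
        exact h z hz
    _ = _ := by ring

/-- Stability persists along a segment of polynomials of constant degree without roots on the
imaginary axis. -/
theorem add_of_segment {q : ℂ[X]} {n : ℕ} (hp : IsHurwitzComplex p)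
    (hdeg : ∀ t ∈ Set.Icc (0 : ℝ) 1, (p + C (t : ℂ) * q).natDegree = n)
    (haxis : ∀ t ∈ Set.Icc (0 : ℝ) 1, ∀ ω : ℝ,
      (p + C (t : ℂ) * q).eval ((ω : ℂ) * Complex.I) ≠ 0) :
    IsHurwitzComplex (p + q) := by
  let P : unitInterval → ℂ[X] := fun t => p + C ((t : ℝ) : ℂ) * q
  have hdegP : ∀ t, (P t).natDegree = n := fun t => hdeg t t.2
  have hne : ∀ t, P t ≠ 0 := fun t h => haxis t t.2 0 (by
    change (P t).eval _ = 0
    simp [h])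
  have hqn : q.natDegree ≤ n := by
    have h0 := hdeg 0 (by simp)
    have h1 := hdeg 1 (by simp)
    have : q = (p + C ((1 : ℝ) : ℂ) * q) - (p + C ((0 : ℝ) : ℂ) * q) := by simp
    rw [this]
    exact (natDegree_sub_le _ _).trans (by simp only [h0, h1, max_self, le_refl])
  let S : Set unitInterval := {t | IsHurwitzComplex (P t)}
  have hopen : IsOpen S := by
    rw [Metric.isOpen_iff]
    intro t ht
    obtain ⟨K, hK, hle⟩ := IsHurwitzComplex.exists_norm_eval_le (p := P t) ht (q := q)
      (hqn.trans (hdegP t).ge)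
    -- A root `z` of `P u` in the closed right half plane would give `|P t z| = |t - u| |q z| ≤ |t -
    -- u| K |P t z| < |P t z|`.
    refine ⟨1 / K, by positivity, fun u hu z hz => ?_⟩
    by_contra! hre
    have h1 := hle z hre
    have h2 : (P t).eval z = (((t : ℝ) - (u : ℝ) : ℝ) : ℂ) * q.eval z := by
      have : (P u).eval z = p.eval z + ((u : ℝ) : ℂ) * q.eval z := by simp [P]
      rw [this] at hz
      have : (P t).eval z = p.eval z + ((t : ℝ) : ℂ) * q.eval z := by simp [P]
      rw [this]
      push_cast
      linear_combination hz
    have h3 : 0 < ‖(P t).eval z‖ := norm_pos_iff.2 (ht.eval_ne_zero hre)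
    have h4 : |(t : ℝ) - (u : ℝ)| < 1 / K := by
      rw [abs_sub_comm]
      exact hu
    rw [lt_div_iff₀ hK] at h4
    have h5 : ‖(P t).eval z‖ = |(t : ℝ) - (u : ℝ)| * ‖q.eval z‖ := by
      rw [h2, norm_mul, Complex.norm_real, Real.norm_eq_abs]
    have h6 : ‖(P t).eval z‖ ≤ (|(t : ℝ) - (u : ℝ)| * K) * ‖(P t).eval z‖ := by
      calc ‖(P t).eval z‖ = |(t : ℝ) - (u : ℝ)| * ‖q.eval z‖ := h5
        _ ≤ |(t : ℝ) - (u : ℝ)| * (K * ‖(P t).eval z‖) := by gcongr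
        _ = _ := by ring
    nlinarith
  have hclosed : IsClosed S := by
    -- The lower bound rules out roots with `Re z > 0`, and `haxis` rules out those with `Re z = 0`,
    -- so these closed conditions characterize stability here.
    have hS : S = ⋂ z ∈ {z : ℂ | 0 ≤ z.re},
        {t | ‖(P t).coeff n‖ * z.re ^ n ≤ ‖(P t).eval z‖} := by
      ext t
      simp only [Set.mem_iInter, Set.mem_ofPred_eq]
      constructor
      · intro ht z hz
        have := IsHurwitzComplex.norm_coeff_mul_re_pow_le (p := P t) ht hz
        rwa [leadingCoeff, hdegP t] at this
      · intro h z hz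
        by_contra! hre
        have h1 := h z hre
        rw [hz, norm_zero] at h1
        have hl : 0 < ‖(P t).coeff n‖ := by
          rw [norm_pos_iff, ← hdegP t]
          exact leadingCoeff_ne_zero.2 (hne t)
        rcases hre.eq_or_lt with h0 | h0
        · apply haxis t t.2 z.im
          have : ((z.im : ℝ) : ℂ) * Complex.I = z := by
            apply Complex.ext <;> simp [h0.symm]
          rw [this]
          exact hz
        · exact absurd h1 (not_le.2 (by positivity))
    rw [hS]
    refine isClosed_biInter fun z _ => isClosed_le ?_ ?_
    · simp only [P, coeff_add, coeff_C_mul]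
      fun_prop
    · simp only [P, eval_add, eval_mul, eval_C]
      fun_prop
  have huniv : S = Set.univ :=
    IsClopen.eq_univ ⟨hclosed, hopen⟩ ⟨0, by simpa [S, P] using hp⟩
  have : (1 : unitInterval) ∈ S := by rw [huniv]; trivial
  simpa [S, P] using this

theorem hasDerivAt_re_mul_eval (d : ℂ) (p : ℂ[X]) (ω : ℝ) :
    HasDerivAt (fun ω : ℝ => (d * p.eval ((ω : ℂ) * Complex.I)).re)
      (d * (p.derivative.eval ((ω : ℂ) * Complex.I) * Complex.I)).re ω := by
  have h1 : HasDerivAt (fun s : ℂ => d * p.eval (s * Complex.I))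
      (d * (p.derivative.eval ((ω : ℂ) * Complex.I) * Complex.I)) (ω : ℂ) := by
    have h2 := (p.hasDerivAt ((ω : ℂ) * Complex.I)).comp (ω : ℂ)
      ((hasDerivAt_id (ω : ℂ)).mul_const Complex.I)
    simpa using h2.const_mul d
  exact h1.real_of_complex

/-- Two stable polynomials whose values on the imaginary axis differ by real multiples of a fixed
complex number cannot have, at some frequency, values on opposite sides of the origin along that
direction. -/
theorem not_opposite {p₁ p₂ : ℂ[X]} (h₁ : IsHurwitzComplex p₁) (h₂ : IsHurwitzComplex p₂)
    (hd₁ : 0 < p₁.natDegree) (hd₂ : 0 < p₂.natDegree) {d : ℂ}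
    (hdiff : ∀ ω : ℝ, (d * p₁.eval ((ω : ℂ) * Complex.I)).re
      = (d * p₂.eval ((ω : ℂ) * Complex.I)).re)
    {ω : ℝ} (hω : (d * p₁.eval ((ω : ℂ) * Complex.I)).re = 0) (hd : d ≠ 0) :
    0 < (d * p₁.eval ((ω : ℂ) * Complex.I)).im * (d * p₂.eval ((ω : ℂ) * Complex.I)).im := by
  have hre : 0 ≤ ((ω : ℂ) * Complex.I).re := by simp
  have hder := (hasDerivAt_re_mul_eval d p₁ ω).unique
    ((hasDerivAt_re_mul_eval d p₂ ω).congr_of_eventuallyEq (Filter.Eventually.of_forall hdiff))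
  have hω₂ := (hdiff ω).symm.trans hω
  -- Where `d p` crosses the imaginary axis, increasing phase ties the sign of the derivative of `Re
  -- (d p)` to that of `Im (d p)`. The derivative is common to both polynomials, so the two
  -- imaginary parts have the same sign.
  have key : ∀ p : ℂ[X], IsHurwitzComplex p → 0 < p.natDegree →
      (d * p.eval ((ω : ℂ) * Complex.I)).re = 0 →
      (d * (p.derivative.eval ((ω : ℂ) * Complex.I) * Complex.I)).re
        * (d * p.eval ((ω : ℂ) * Complex.I)).im < 0 := by
    intro p hp hdp h0
    have h := hp.re_conj_mul_eval_derivative_pos hdp hre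
    have hn : 0 < Complex.normSq d := Complex.normSq_pos.2 hd
    have := mul_pos hn h
    generalize p.eval ((ω : ℂ) * Complex.I) = v at *
    generalize p.derivative.eval ((ω : ℂ) * Complex.I) = w at *
    have e : (d * (w * Complex.I)).re * (d * v).im
        = - (Complex.normSq d * ((starRingEnd ℂ) v * w).re)
          + (d * v).re * (d * w).re := by
      simp [Complex.normSq_apply]
      ring
    rw [e, h0]
    linarith
  have k₁ := key p₁ h₁ hd₁ hω
  have k₂ := key p₂ h₂ hd₂ hω₂
  rw [hder] at k₁
  generalize (d * (p₂.derivative.eval ((ω : ℂ) * Complex.I) * Complex.I)).re = k at *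
  rcases lt_trichotomy k 0 with hk | hk | hk
  · exact mul_pos (by nlinarith) (by nlinarith)
  · simp [hk] at k₁
  · exact mul_pos_of_neg_of_neg (by nlinarith) (by nlinarith)

end IsHurwitzComplex

/-! ### Minimizing a linear functional over the box -/

/-- The index of the endpoint that minimizes `c * x`, with the tie `c = 0` broken by `τ`. -/
noncomputable def signIndex (τ : ℕ) (c : ℝ) : ℕ := if 0 < c then 1 else if c < 0 then 2 else τ

theorem signIndex_mem {τ : ℕ} (hτ : τ ∈ ({1, 2} : Set ℕ)) (c : ℝ) :
    signIndex τ c ∈ ({1, 2} : Set ℕ) := by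
  unfold signIndex
  split_ifs <;> simp_all

theorem signIndex_congr {c c' : ℝ} (h : 0 < c * c') (τ τ' : ℕ) :
    signIndex τ c = signIndex τ' c' := by
  rcases lt_trichotomy c 0 with hc | hc | hc
  · have : c' < 0 := by nlinarith
    simp [signIndex, hc, this, hc.not_gt, this.not_gt]
  · simp [hc] at h
  · have : 0 < c' := by nlinarith
    simp [signIndex, hc, this]

/-- The tie rule only acts when `c = 0`, where the product vanishes. Hence changing it leaves `Re (d
·)` of a vertex combination unchanged at every frequency. -/
theorem mul_signIndex (c : ℝ) (A : ℕ → ℝ) (τ τ' : ℕ) :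
    c * A (signIndex τ c) = c * A (signIndex τ' c) := by
  unfold signIndex
  split_ifs with h1 h2
  · rfl
  · rfl
  · have : c = 0 := by linarith
    simp [this]

/-- Where a minimizer of `c * x` over an interval lies. -/
theorem minimizer_between {c x : ℝ} {A : ℕ → ℝ} (hx : x ∈ Set.Icc (A 1) (A 2))
    (hmin : ∀ x' ∈ Set.Icc (A 1) (A 2), c * x ≤ c * x') :
    A (signIndex 1 c) ≤ x ∧ x ≤ A (signIndex 2 c) ∧ c * A (signIndex 1 c) = c * x := by
  have h1 := hmin (A 1) ⟨le_rfl, hx.1.trans hx.2⟩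
  have h2 := hmin (A 2) ⟨hx.1.trans hx.2, le_rfl⟩
  rcases lt_trichotomy c 0 with hc | hc | hc
  · have h3 : A 2 ≤ x := (mul_le_mul_left_of_neg hc).1 h2
    have h4 : A 2 = x := le_antisymm h3 hx.2
    simp [signIndex, hc, hc.not_gt, h4]
  · simp [signIndex, hc, hx.1, hx.2]
  · have h3 : x ≤ A 1 := (mul_le_mul_iff_right₀ hc).1 h1
    have h4 : A 1 = x := le_antisymm hx.1 h3
    simp [signIndex, hc, h4]

/-- The value of `z f + g` when `f` and `g` have the values `x + iy` and `x' + iy'`. -/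
def combinedValue (z : ℂ) (v : (ℝ × ℝ) × (ℝ × ℝ)) : ℂ :=
  z * (v.1.1 + v.1.2 * Complex.I) + (v.2.1 + v.2.2 * Complex.I)

theorem mul_combinedValue_re (d z : ℂ) (v : (ℝ × ℝ) × (ℝ × ℝ)) :
    (d * combinedValue z v).re = (d * z).re * v.1.1 + -(d * z).im * v.1.2 + d.re * v.2.1
      + -d.im * v.2.2 := by
  simp [combinedValue]
  ring

theorem mul_combinedValue_im (d z : ℂ) (v : (ℝ × ℝ) × (ℝ × ℝ)) :
    (d * combinedValue z v).im = (d * z).im * v.1.1 + (d * z).re * v.1.2 + d.im * v.2.1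
      + d.re * v.2.2 := by
  simp [combinedValue]
  ring

/-- A product of four intervals. -/
def box (A B P Q : ℕ → ℝ) : Set ((ℝ × ℝ) × (ℝ × ℝ)) :=
  (Set.Icc (A 1) (A 2) ×ˢ Set.Icc (B 1) (B 2)) ×ˢ (Set.Icc (P 1) (P 2) ×ˢ Set.Icc (Q 1) (Q 2))

/-- If the value set of `z f + g` at some frequency lies in a closed half plane through the origin,
then it omits the origin, provided that the vertex combinations which can bound the value set are
stable. -/
theorem not_supported_at_zero {z : ℂ} (hz : 0 < z.re) {A B P Q : ℕ → ℝ → ℝ} {F G : ℕ → ℕ → ℂ[X]}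
    (hF : ∀ i j (ω : ℝ), (F i j).eval ((ω : ℂ) * Complex.I) = A i ω + B j ω * Complex.I)
    (hG : ∀ i j (ω : ℝ), (G i j).eval ((ω : ℂ) * Complex.I) = P i ω + Q j ω * Complex.I)
    (hT : ∀ i₁ ∈ ({1, 2} : Set ℕ), ∀ j₁ ∈ ({1, 2} : Set ℕ), ∀ i₂ ∈ ({1, 2} : Set ℕ),
      ∀ j₂ ∈ ({1, 2} : Set ℕ), (i₁ = i₂ ∨ j₁ = j₂) → (z = 1 → i₁ = i₂ ∧ j₁ = j₂) →
      IsHurwitzComplex (C z * F i₂ j₂ + G i₁ j₁) ∧ 0 < (C z * F i₂ j₂ + G i₁ j₁).natDegree)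
    {ω : ℝ} {d : ℂ} (hd : d ≠ 0)
    (hsupp : ∀ v ∈ box (A · ω) (B · ω) (P · ω) (Q · ω), 0 ≤ (d * combinedValue z v).re)
    {v : (ℝ × ℝ) × (ℝ × ℝ)} (hv : v ∈ box (A · ω) (B · ω) (P · ω) (Q · ω)) :
    combinedValue z v ≠ 0 := by
  intro h0
  have heval : ∀ i j k l (ω : ℝ), (C z * F i j + G k l).eval ((ω : ℂ) * Complex.I)
      = combinedValue z ((A i ω, B j ω), (P k ω, Q l ω)) := by
    intro i j k l ω
    simp [combinedValue, hF, hG]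
  have hre0 : (d * combinedValue z v).re = 0 := by simp [h0]
  have him0 : (d * combinedValue z v).im = 0 := by simp [h0]
  obtain ⟨⟨x₁, y₁⟩, ⟨x₂, y₂⟩⟩ := v
  obtain ⟨⟨hx₁, hy₁⟩, ⟨hx₂, hy₂⟩⟩ := hv
  simp only at hx₁ hy₁ hx₂ hy₂
  rw [mul_combinedValue_re] at hre0
  rw [mul_combinedValue_im] at him0
  simp only [mul_combinedValue_re] at hsupp
  have hone : z = 1 → (d * z).re = d.re ∧ (d * z).im = d.im := by
    rintro rfl
    simp
  -- This is where `Re z > 0` enters: it forces `a p > 0` or `b q > 0` below.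
  have hpos : 0 < (d * z).re * d.re + (d * z).im * d.im := by
    have e : (d * z).re * d.re + (d * z).im * d.im = Complex.normSq d * z.re := by
      simp [Complex.normSq_apply]
      ring
    rw [e]
    exact mul_pos (Complex.normSq_pos.2 hd) hz
  have hdiff := fun p₁ p₂ h₁ h₂ hd₁ hd₂ hdiff hω =>
    IsHurwitzComplex.not_opposite (p₁ := p₁) (p₂ := p₂) h₁ h₂ hd₁ hd₂ (d := d) hdiff (ω := ω) hω hd
  generalize ea : (d * z).re = a at *
  generalize eb : (d * z).im = b at *
  generalize ep : d.re = p at *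
  generalize eq : d.im = q at *
  simp only at hre0 him0
  -- The functional is nonnegative on the box and zero at the given point, so each coordinate
  -- minimizes its own term.
  have m₁ := minimizer_between (c := a) (A := fun i => A i ω) hx₁ fun x hx => by
    have := hsupp ((x, y₁), (x₂, y₂)) ⟨⟨hx, hy₁⟩, ⟨hx₂, hy₂⟩⟩
    simp only at this
    linarith
  have m₂ := minimizer_between (c := -b) (A := fun i => B i ω) hy₁ fun x hx => by
    have := hsupp ((x₁, x), (x₂, y₂)) ⟨⟨hx₁, hx⟩, ⟨hx₂, hy₂⟩⟩
    simp only at this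
    linarith
  have m₃ := minimizer_between (c := p) (A := fun i => P i ω) hx₂ fun x hx => by
    have := hsupp ((x₁, y₁), (x, y₂)) ⟨⟨hx₁, hy₁⟩, ⟨hx, hy₂⟩⟩
    simp only at this
    linarith
  have m₄ := minimizer_between (c := -q) (A := fun i => Q i ω) hy₂ fun x hx => by
    have := hsupp ((x₁, y₁), (x₂, x)) ⟨⟨hx₁, hy₁⟩, ⟨hx₂, hx⟩⟩
    simp only at this
    linarith
  obtain ⟨m₁l, m₁u, m₁e⟩ := m₁
  obtain ⟨m₂l, m₂u, m₂e⟩ := m₂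
  obtain ⟨m₃l, m₃u, m₃e⟩ := m₃
  obtain ⟨m₄l, m₄u, m₄e⟩ := m₄
  have one_mem : (1 : ℕ) ∈ ({1, 2} : Set ℕ) := by simp
  have two_mem : (2 : ℕ) ∈ ({1, 2} : Set ℕ) := by simp
  -- If `b q > 0`, the imaginary coordinates are pinned to endpoints of the same index. Only the
  -- real ones can be free, and `τ = 1, 2` gives the two ends of that face.
  rcases lt_or_ge 0 (b * q) with hbq | hbq
  · have hjl : signIndex 1 (-q) = signIndex 1 (-b) := signIndex_congr (by linarith) 1 1
    have hb : b ≠ 0 := by rintro rfl; simp at hbq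
    have hq : q ≠ 0 := by rintro rfl; simp at hbq
    have hB := mul_left_cancel₀ (neg_ne_zero.2 hb) m₂e
    have hQ := mul_left_cancel₀ (neg_ne_zero.2 hq) m₄e
    have t : ∀ τ ∈ ({1, 2} : Set ℕ), _ := fun τ hτ =>
      hT (signIndex τ p) (signIndex_mem hτ p) (signIndex 1 (-q)) (signIndex_mem one_mem _)
        (signIndex τ a) (signIndex_mem hτ a) (signIndex 1 (-b)) (signIndex_mem one_mem _)
        (Or.inr hjl) (fun h => ⟨by rw [(hone h).1], hjl⟩)
    have h := hdiff _ _ (t 1 one_mem).1 (t 2 two_mem).1 (t 1 one_mem).2 (t 2 two_mem).2 (by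
      intro ω'
      simp only [heval, mul_combinedValue_re, ea, eb, ep, eq]
      have e₁ := mul_signIndex a (fun i => A i ω') 1 2
      have e₂ := mul_signIndex p (fun i => P i ω') 1 2
      linarith) (by
      simp only [heval, mul_combinedValue_re, ea, eb, ep, eq]
      linarith)
    simp only [heval, mul_combinedValue_im, ea, eb, ep, eq, hB, hQ] at h
    -- Relative to the zero at the given point, the imaginary parts change by `b (A - x₁) + q (P -
    -- x₂)`. Since `b` and `q` have the same sign, the two ends have opposite weak signs.
    rcases lt_or_gt_of_ne hb with hb' | hb'
    · have hq' : q < 0 := by nlinarith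
      refine absurd h (not_lt.2 (mul_nonpos_iff.2 (Or.inl ⟨?_, ?_⟩)))
      · linarith [mul_nonneg_of_nonpos_of_nonpos hb'.le (sub_nonpos.2 m₁l),
          mul_nonneg_of_nonpos_of_nonpos hq'.le (sub_nonpos.2 m₃l)]
      · linarith [mul_nonneg_of_nonpos_of_nonpos hb'.le (sub_nonpos.2 m₁u),
          mul_nonneg_of_nonpos_of_nonpos hq'.le (sub_nonpos.2 m₃u)]
    · have hq' : 0 < q := by nlinarith
      refine absurd h (not_lt.2 (mul_nonpos_iff.2 (Or.inr ⟨?_, ?_⟩)))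
      · linarith [mul_nonneg hb'.le (sub_nonneg.2 m₁l),
          mul_nonneg hq'.le (sub_nonneg.2 m₃l)]
      · linarith [mul_nonneg hb'.le (sub_nonneg.2 m₁u),
          mul_nonneg hq'.le (sub_nonneg.2 m₃u)]
  · have hap : 0 < a * p := by linarith
    have hik : signIndex 1 p = signIndex 1 a := signIndex_congr (by linarith) 1 1
    have ha : a ≠ 0 := by rintro rfl; simp at hap
    have hp : p ≠ 0 := by rintro rfl; simp at hap
    have hA := mul_left_cancel₀ ha m₁e
    have hP := mul_left_cancel₀ hp m₃e
    have t : ∀ τ ∈ ({1, 2} : Set ℕ), _ := fun τ hτ =>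
      hT (signIndex 1 p) (signIndex_mem one_mem p) (signIndex τ (-q)) (signIndex_mem hτ _)
        (signIndex 1 a) (signIndex_mem one_mem a) (signIndex τ (-b)) (signIndex_mem hτ _)
        (Or.inl hik) (fun h => ⟨hik, by rw [(hone h).2]⟩)
    have h := hdiff _ _ (t 1 one_mem).1 (t 2 two_mem).1 (t 1 one_mem).2 (t 2 two_mem).2 (by
      intro ω'
      simp only [heval, mul_combinedValue_re, ea, eb, ep, eq]
      have e₁ := mul_signIndex (-b) (fun i => B i ω') 1 2
      have e₂ := mul_signIndex (-q) (fun i => Q i ω') 1 2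
      linarith) (by
      simp only [heval, mul_combinedValue_re, ea, eb, ep, eq]
      linarith)
    simp only [heval, mul_combinedValue_im, ea, eb, ep, eq, hA, hP] at h
    rcases lt_or_gt_of_ne ha with ha' | ha'
    · have hp' : p < 0 := by nlinarith
      refine absurd h (not_lt.2 (mul_nonpos_iff.2 (Or.inl ⟨?_, ?_⟩)))
      · linarith [mul_nonneg_of_nonpos_of_nonpos ha'.le (sub_nonpos.2 m₂l),
          mul_nonneg_of_nonpos_of_nonpos hp'.le (sub_nonpos.2 m₄l)]
      · linarith [mul_nonneg_of_nonpos_of_nonpos ha'.le (sub_nonpos.2 m₂u),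
          mul_nonneg_of_nonpos_of_nonpos hp'.le (sub_nonpos.2 m₄u)]
    · have hp' : 0 < p := by nlinarith
      refine absurd h (not_lt.2 (mul_nonpos_iff.2 (Or.inr ⟨?_, ?_⟩)))
      · linarith [mul_nonneg ha'.le (sub_nonneg.2 m₂l),
          mul_nonneg hp'.le (sub_nonneg.2 m₄l)]
      · linarith [mul_nonneg ha'.le (sub_nonneg.2 m₂u),
          mul_nonneg hp'.le (sub_nonneg.2 m₄u)]

/-! ### Separation and continuation in frequency -/

theorem isLinearMap_combinedValue (z : ℂ) : IsLinearMap ℝ (combinedValue z) where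
  map_add v w := by
    simp only [combinedValue, Prod.fst_add, Prod.snd_add]
    push_cast
    ring
  map_smul c v := by
    simp only [combinedValue, Prod.smul_fst, Prod.smul_snd, smul_eq_mul, Complex.real_smul]
    push_cast
    ring

theorem continuous_combinedValue (z : ℂ) : Continuous (combinedValue z) := by
  unfold combinedValue
  fun_prop

theorem convex_box (A B P Q : ℕ → ℝ) : Convex ℝ (box A B P Q) :=
  ((convex_Icc _ _).prod (convex_Icc _ _)).prod ((convex_Icc _ _).prod (convex_Icc _ _))

theorem isCompact_box (A B P Q : ℕ → ℝ) : IsCompact (box A B P Q) :=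
  (isCompact_Icc.prod isCompact_Icc).prod (isCompact_Icc.prod isCompact_Icc)

/-- A value set that omits the origin is separated from it by a unit functional. -/
theorem exists_unit_supporting {z : ℂ} {A B P Q : ℕ → ℝ} (hne : (box A B P Q).Nonempty)
    (h : ∀ v ∈ box A B P Q, combinedValue z v ≠ 0) :
    ∃ d : Metric.sphere (0 : ℂ) 1, ∀ v ∈ box A B P Q, 0 ≤ ((d : ℂ) * combinedValue z v).re := by
  have hconv : Convex ℝ (combinedValue z '' box A B P Q) :=
    (convex_box A B P Q).is_linear_image (isLinearMap_combinedValue z)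
  have hclosed : IsClosed (combinedValue z '' box A B P Q) :=
    ((isCompact_box A B P Q).image (continuous_combinedValue z)).isClosed
  obtain ⟨φ, u, hu, hφ⟩ := geometric_hahn_banach_point_closed (x := (0 : ℂ)) hconv hclosed
    (by rintro ⟨v, hv, hv0⟩; exact h v hv hv0)
  rw [map_zero] at hu
  -- Every real functional on `ℂ` is `w ↦ Re (e w)` for this `e`; normalizing it makes the space of
  -- directions compact.
  let e : ℂ := φ 1 - φ Complex.I * Complex.I
  have he : ∀ w : ℂ, (e * w).re = φ w := by
    intro w
    have hw : w = w.re • (1 : ℂ) + w.im • Complex.I := by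
      simp [Complex.re_add_im]
    conv_rhs => rw [hw]
    rw [map_add, map_smul, map_smul]
    simp [e]
    ring
  have hpos : ∀ v ∈ box A B P Q, 0 < (e * combinedValue z v).re := fun v hv => by
    rw [he]
    exact hu.trans (hφ _ ⟨v, hv, rfl⟩)
  have he0 : e ≠ 0 := by
    obtain ⟨v, hv⟩ := hne
    intro h0
    have := hpos v hv
    simp [h0] at this
  refine ⟨⟨((‖e‖⁻¹ : ℝ) : ℂ) * e, ?_⟩, fun v hv => ?_⟩
  · simp [he0]
  · rw [mul_assoc, Complex.re_ofReal_mul]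
    exact mul_nonneg (by positivity) (hpos v hv).le

/-- The point of `[a, b]` with parameter `s`. -/
def lerp (a b : ℝ) (s : unitInterval) : ℝ := (1 - (s : ℝ)) * a + s * b

theorem lerp_mem {a b : ℝ} (h : a ≤ b) (s : unitInterval) : lerp a b s ∈ Set.Icc a b := by
  have h0 := s.2.1
  have h1 := s.2.2
  unfold lerp
  constructor <;> nlinarith

theorem exists_lerp {a b x : ℝ} (hx : x ∈ Set.Icc a b) : ∃ s, lerp a b s = x := by
  have h := hx
  rw [← segment_eq_Icc (hx.1.trans hx.2), segment_eq_image] at h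
  obtain ⟨t, ht, rfl⟩ := h
  exact ⟨⟨t, ht⟩, by simp [lerp]⟩

/-- A parametrization of a product of four intervals. -/
def boxPoint (A B P Q : ℕ → ℝ)
    (s : (unitInterval × unitInterval) × (unitInterval × unitInterval)) : (ℝ × ℝ) × (ℝ × ℝ) :=
  ((lerp (A 1) (A 2) s.1.1, lerp (B 1) (B 2) s.1.2),
    (lerp (P 1) (P 2) s.2.1, lerp (Q 1) (Q 2) s.2.2))

theorem range_boxPoint {A B P Q : ℕ → ℝ} (hA : A 1 ≤ A 2) (hB : B 1 ≤ B 2) (hP : P 1 ≤ P 2)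
    (hQ : Q 1 ≤ Q 2) : Set.range (boxPoint A B P Q) = box A B P Q := by
  ext v
  constructor
  · rintro ⟨s, rfl⟩
    exact ⟨⟨lerp_mem hA _, lerp_mem hB _⟩, ⟨lerp_mem hP _, lerp_mem hQ _⟩⟩
  · rintro ⟨⟨h1, h2⟩, ⟨h3, h4⟩⟩
    obtain ⟨s1, e1⟩ := exists_lerp h1
    obtain ⟨s2, e2⟩ := exists_lerp h2
    obtain ⟨s3, e3⟩ := exists_lerp h3
    obtain ⟨s4, e4⟩ := exists_lerp h4
    exact ⟨((s1, s2), (s3, s4)), by simp [boxPoint, e1, e2, e3, e4]⟩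

/-- Zero exclusion: the value set of `z f + g` avoids the origin at all frequencies if the relevant
vertex combinations are stable. -/
theorem combinedValue_ne_zero {z : ℂ} (hz : 0 < z.re) {A B P Q : ℕ → ℝ → ℝ}
    {F G : ℕ → ℕ → ℂ[X]}
    (hF : ∀ i j (ω : ℝ), (F i j).eval ((ω : ℂ) * Complex.I) = A i ω + B j ω * Complex.I)
    (hG : ∀ i j (ω : ℝ), (G i j).eval ((ω : ℂ) * Complex.I) = P i ω + Q j ω * Complex.I)
    (hAc : ∀ i, Continuous (A i)) (hBc : ∀ i, Continuous (B i))
    (hPc : ∀ i, Continuous (P i)) (hQc : ∀ i, Continuous (Q i))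
    (hA : ∀ ω, 0 ≤ ω → A 1 ω ≤ A 2 ω) (hB : ∀ ω, 0 ≤ ω → B 1 ω ≤ B 2 ω)
    (hP : ∀ ω, 0 ≤ ω → P 1 ω ≤ P 2 ω) (hQ : ∀ ω, 0 ≤ ω → Q 1 ω ≤ Q 2 ω)
    (hB0 : ∀ i, B i 0 = 0) (hQ0 : ∀ i, Q i 0 = 0)
    (hdiag : ∀ i ∈ ({1, 2} : Set ℕ), ∀ j ∈ ({1, 2} : Set ℕ),
      IsHurwitzComplex (F i j + G i j) ∧ 0 < (F i j + G i j).natDegree)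
    (hT : ∀ i₁ ∈ ({1, 2} : Set ℕ), ∀ j₁ ∈ ({1, 2} : Set ℕ), ∀ i₂ ∈ ({1, 2} : Set ℕ),
      ∀ j₂ ∈ ({1, 2} : Set ℕ), (i₁ = i₂ ∨ j₁ = j₂) → (z = 1 → i₁ = i₂ ∧ j₁ = j₂) →
      IsHurwitzComplex (C z * F i₂ j₂ + G i₁ j₁) ∧ 0 < (C z * F i₂ j₂ + G i₁ j₁).natDegree)
    {ω : ℝ} (hω : 0 ≤ ω) {v : (ℝ × ℝ) × (ℝ × ℝ)}
    (hv : v ∈ box (A · ω) (B · ω) (P · ω) (Q · ω)) : combinedValue z v ≠ 0 := by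
  intro hv0
  have hrange : ∀ ω, 0 ≤ ω → Set.range (boxPoint (A · ω) (B · ω) (P · ω) (Q · ω))
      = box (A · ω) (B · ω) (P · ω) (Q · ω) := fun ω h =>
    range_boxPoint (hA ω h) (hB ω h) (hP ω h) (hQ ω h)
  -- At frequency 0 both rectangles are real segments, so `z x₁ + x₂ = 0` forces `z` real or `x₁ =
  -- x₂ = 0`. The cases use the multiplier `r = z.re` or `r = 1`. Then `r A i + P i` changes sign
  -- weakly between `i = 1` and `i = 2`, against `not_opposite` with `d = I`.
  have hstart : ∀ v ∈ box (A · 0) (B · 0) (P · 0) (Q · 0), combinedValue z v ≠ 0 := by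
    rintro ⟨⟨x₁, y₁⟩, ⟨x₂, y₂⟩⟩ ⟨⟨hx₁, hy₁⟩, ⟨hx₂, hy₂⟩⟩ h0
    simp only [hB0, hQ0, Set.Icc_self, Set.mem_singleton_iff, Set.mem_Icc] at hx₁ hy₁ hx₂ hy₂
    subst hy₁ hy₂
    have one_mem : (1 : ℕ) ∈ ({1, 2} : Set ℕ) := by simp
    have two_mem : (2 : ℕ) ∈ ({1, 2} : Set ℕ) := by simp
    have key : ∀ r : ℝ, 0 < r → r * x₁ + x₂ = 0 →
        (∀ i ∈ ({1, 2} : Set ℕ), IsHurwitzComplex (C (r : ℂ) * F i 1 + G i 1) ∧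
          0 < (C (r : ℂ) * F i 1 + G i 1).natDegree) → False := by
      intro r hr hrx hst
      have h := IsHurwitzComplex.not_opposite (d := Complex.I) (ω := 0) (hst 1 one_mem).1
        (hst 2 two_mem).1 (hst 1 one_mem).2 (hst 2 two_mem).2
        (by intro ω; simp only [eval_add, eval_mul, eval_C, hF, hG]; simp)
        (by simp only [eval_add, eval_mul, eval_C, hF, hG]; simp [hB0, hQ0])
        Complex.I_ne_zero
      simp only [eval_add, eval_mul, eval_C, hF, hG] at h
      simp only [hB0, hQ0, Complex.ofReal_zero, zero_mul, add_zero, Complex.I_mul_im,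
        Complex.add_re, Complex.re_ofReal_mul, Complex.ofReal_re] at h
      refine absurd h (not_lt.2 (mul_nonpos_iff.2 (Or.inr ⟨?_, ?_⟩)))
      · nlinarith
      · nlinarith
    have hre := congrArg Complex.re h0
    have him := congrArg Complex.im h0
    simp [combinedValue] at hre him
    rcases him with him | him
    · have hzr : z = (z.re : ℂ) := by apply Complex.ext <;> simp [him]
      refine key z.re hz hre fun i hi => ?_
      rw [← hzr]
      exact hT i hi 1 one_mem i hi 1 one_mem (Or.inl rfl) fun _ => ⟨rfl, rfl⟩
    · refine key 1 one_pos (by rw [him] at hre ⊢; linarith) fun i hi => ?_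
      simpa using hdiag i hi 1 one_mem
  -- On nonnegative frequencies, `S₁` says that the value set contains 0 and `S₂` that a closed half
  -- plane through 0 contains it. Both are projections along compact factors, hence closed, and they
  -- cover `[0, ω]`, so they meet.
  let S₁ : Set ℝ := Prod.fst '' {w : ℝ × ((unitInterval × unitInterval) × _) |
    combinedValue z (boxPoint (A · w.1) (B · w.1) (P · w.1) (Q · w.1) w.2) = 0}
  let S₂ : Set ℝ := Prod.fst '' {w : ℝ × Metric.sphere (0 : ℂ) 1 | ∀ s,
    0 ≤ ((w.2 : ℂ) * combinedValue z
      (boxPoint (A · w.1) (B · w.1) (P · w.1) (Q · w.1) s)).re}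
  have hS₁ : IsClosed S₁ := by
    refine isClosedMap_fst_of_compactSpace _ (isClosed_eq ?_ continuous_const)
    refine (continuous_combinedValue z).comp ?_
    unfold boxPoint lerp
    fun_prop
  have hS₂ : IsClosed S₂ := by
    refine isClosedMap_fst_of_compactSpace _ ?_
    rw [Set.ofPred_forall]
    refine isClosed_iInter fun s => isClosed_le continuous_const ?_
    refine Complex.continuous_re.comp ((continuous_subtype_val.comp continuous_snd).mul
      ((continuous_combinedValue z).comp ?_))
    unfold boxPoint lerp
    fun_prop
  have hmem₁ : ∀ ω, 0 ≤ ω → ∀ v ∈ box (A · ω) (B · ω) (P · ω) (Q · ω), combinedValue z v = 0 →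
      ω ∈ S₁ := by
    intro ω hω v hv h0
    rw [← hrange ω hω] at hv
    obtain ⟨s, rfl⟩ := hv
    exact ⟨(ω, s), h0, rfl⟩
  have hmem₂ : ∀ ω, 0 ≤ ω → (∀ v ∈ box (A · ω) (B · ω) (P · ω) (Q · ω),
      combinedValue z v ≠ 0) → ω ∈ S₂ := by
    intro ω hω h
    obtain ⟨d, hd⟩ := exists_unit_supporting
      (by rw [← hrange ω hω]; exact Set.range_nonempty _) h
    refine ⟨(ω, d), fun s => hd _ ?_, rfl⟩
    rw [← hrange ω hω]
    exact ⟨s, rfl⟩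
  obtain ⟨ω', hω', h₁, h₂⟩ := isPreconnected_closed_iff.1 (isPreconnected_Icc (a := (0 : ℝ)) (b := ω))
    S₁ S₂ hS₁ hS₂
    (by
      intro w hw
      by_cases h : ∀ v ∈ box (A · w) (B · w) (P · w) (Q · w), combinedValue z v ≠ 0
      · exact Or.inr (hmem₂ w hw.1 h)
      · push Not at h
        obtain ⟨v, hv, h0⟩ := h
        exact Or.inl (hmem₁ w hw.1 v hv h0))
    ⟨ω, ⟨hω, le_rfl⟩, hmem₁ ω hω v hv hv0⟩ ⟨0, ⟨le_rfl, hω⟩, hmem₂ 0 le_rfl hstart⟩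
  obtain ⟨⟨_, s⟩, hs, rfl⟩ := h₁
  obtain ⟨⟨_, d⟩, hd, rfl⟩ := h₂
  have hd0 : (d : ℂ) ≠ 0 := by
    have := mem_sphere_zero_iff_norm.1 d.2
    intro h0
    simp [h0] at this
  refine not_supported_at_zero hz hF hG hT hd0 (fun v hv => ?_)
    (by rw [← hrange _ hω'.1]; exact ⟨s, rfl⟩) hs
  rw [← hrange _ hω'.1] at hv
  obtain ⟨s', rfl⟩ := hv
  exact hd s'

/-! ### Kharitonov vertices and value rectangles -/

theorem sum_range_even_add_odd {M : Type*} [AddCommMonoid M] (F : ℕ → M) (d : ℕ) :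
    ∑ l ∈ Finset.range (d + 1), F l = ∑ k ∈ Finset.range (d / 2 + 1), F (2 * k)
      + ∑ k ∈ Finset.range ((d + 1) / 2), F (2 * k + 1) := by
  induction d with
  | zero => simp
  | succ d ih =>
    rw [Finset.sum_range_succ, ih]
    rcases Nat.even_or_odd' d with ⟨e, rfl | rfl⟩
    · have h1 : (2 * e + 1) / 2 = e := by omega
      have h2 : (2 * e + 1 + 1) / 2 = e + 1 := by omega
      have h3 : 2 * e / 2 = e := by omega
      rw [h1, h2, h3, Finset.sum_range_succ (fun k => F (2 * k + 1)) e, add_assoc]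
    · have h1 : (2 * e + 1) / 2 = e := by omega
      have h2 : (2 * e + 1 + 1) / 2 = e + 1 := by omega
      have h3 : (2 * e + 1 + 1 + 1) / 2 = e + 1 := by omega
      rw [h1, h2, h3, Finset.sum_range_succ (fun k => F (2 * k)) (e + 1)]
      have h4 : 2 * (e + 1) = 2 * e + 1 + 1 := by ring
      rw [h4]
      abel

theorem vertexCoeff_mem {lo hi : ℕ → ℝ} {l : ℕ} (h : lo l ≤ hi l) (i k : ℕ) :
    vertexCoeff lo hi i k l ∈ Set.Icc (lo l) (hi l) := by
  unfold vertexCoeff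
  split_ifs <;> simp [h]

theorem kharitonovVertex_mem_intervalFamily {d : ℕ} {lo hi : ℕ → ℝ} (h : ∀ i ≤ d, lo i ≤ hi i)
    (i j : ℕ) : kharitonovVertex d lo hi i j ∈ intervalFamily d lo hi := by
  refine ⟨fun l => vertexCoeff lo hi (if Even l then i else j) (l / 2) l,
    fun l hl => vertexCoeff_mem (h l hl) _ _, ?_⟩
  rw [sum_range_even_add_odd]
  unfold kharitonovVertex vertexEven vertexOdd
  congr 1
  · rw [Polynomial.sum_comp]
    refine Finset.sum_congr rfl fun k _ => ?_
    simp [pow_mul]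
  · rw [Polynomial.sum_comp, Finset.mul_sum]
    refine Finset.sum_congr rfl fun k _ => ?_
    have h1 : (2 * k + 1) / 2 = k := by omega
    simp [pow_succ, pow_mul, h1]
    ring

/-- The real part of a Kharitonov vertex at `iω`. -/
noncomputable def vertexRe (d : ℕ) (lo hi : ℕ → ℝ) (i : ℕ) (ω : ℝ) : ℝ := (vertexEven d lo hi i).eval (-ω ^ 2)

/-- The imaginary part of a Kharitonov vertex at `iω`. -/
noncomputable def vertexIm (d : ℕ) (lo hi : ℕ → ℝ) (j : ℕ) (ω : ℝ) : ℝ :=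
  ω * (vertexOdd d lo hi j).eval (-ω ^ 2)

theorem eval_map_kharitonovVertex (d : ℕ) (lo hi : ℕ → ℝ) (i j : ℕ) (ω : ℝ) :
    ((kharitonovVertex d lo hi i j).map (algebraMap ℝ ℂ)).eval ((ω : ℂ) * Complex.I)
      = vertexRe d lo hi i ω + vertexIm d lo hi j ω * Complex.I := by
  have hsq : ((ω : ℂ) * Complex.I) ^ 2 = algebraMap ℝ ℂ (-ω ^ 2) := by
    rw [mul_pow, Complex.I_sq]
    simp
  have hev : ∀ p : ℝ[X], aeval (((ω : ℂ) * Complex.I) ^ 2) p = ((p.eval (-ω ^ 2) : ℝ) : ℂ) := by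
    intro p
    rw [hsq, aeval_algebraMap_apply_eq_algebraMap_eval]
    rfl
  rw [eval_map_algebraMap]
  simp only [kharitonovVertex, map_add, map_mul, aeval_comp, aeval_X, map_pow, vertexRe, vertexIm]
  rw [hev, hev]
  push_cast
  ring

theorem continuous_vertexRe (d : ℕ) (lo hi : ℕ → ℝ) (i : ℕ) : Continuous (vertexRe d lo hi i) := by
  unfold vertexRe
  fun_prop

theorem continuous_vertexIm (d : ℕ) (lo hi : ℕ → ℝ) (i : ℕ) : Continuous (vertexIm d lo hi i) := by
  unfold vertexIm
  fun_prop

/-- The sign of `(-ω ^ 2) ^ k` alternates with `k`, and the alternating endpoint pattern compensates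
for it term by term. -/
theorem vertexCoeff_mul_neg_pow_le {lo hi : ℕ → ℝ} {c ω : ℝ} {k l : ℕ}
    (hc : c ∈ Set.Icc (lo l) (hi l)) :
    vertexCoeff lo hi 1 k l * (-ω ^ 2) ^ k ≤ c * (-ω ^ 2) ^ k ∧
      c * (-ω ^ 2) ^ k ≤ vertexCoeff lo hi 2 k l * (-ω ^ 2) ^ k := by
  have hω : 0 ≤ ω ^ 2 := sq_nonneg ω
  rcases Nat.even_or_odd k with hk | hk
  · have hp : 0 ≤ (-ω ^ 2) ^ k := hk.pow_nonneg _
    simp only [vertexCoeff, hk, if_true]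
    exact ⟨mul_le_mul_of_nonneg_right hc.1 hp,
      by simpa using mul_le_mul_of_nonneg_right hc.2 hp⟩
  · have hp : (-ω ^ 2) ^ k ≤ 0 := hk.pow_nonpos (by linarith)
    simp only [vertexCoeff, Nat.not_even_iff_odd.2 hk, if_false, if_true]
    exact ⟨mul_le_mul_of_nonpos_right hc.2 hp,
      by simpa using mul_le_mul_of_nonpos_right hc.1 hp⟩

/-- The value set of an interval family at `iω` with `ω ≥ 0` lies in the rectangle spanned by the
Kharitonov vertices. -/
theorem exists_eval_eq_of_mem_intervalFamily {d : ℕ} {lo hi : ℕ → ℝ} {p : ℝ[X]}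
    (hp : p ∈ intervalFamily d lo hi) {ω : ℝ} (hω : 0 ≤ ω) :
    ∃ x ∈ Set.Icc (vertexRe d lo hi 1 ω) (vertexRe d lo hi 2 ω),
      ∃ y ∈ Set.Icc (vertexIm d lo hi 1 ω) (vertexIm d lo hi 2 ω),
        (p.map (algebraMap ℝ ℂ)).eval ((ω : ℂ) * Complex.I) = x + y * Complex.I := by
  obtain ⟨c, hc, rfl⟩ := hp
  have hre : ∀ i, vertexRe d lo hi i ω = ∑ k ∈ Finset.range (d / 2 + 1),
      vertexCoeff lo hi i k (2 * k) * (-ω ^ 2) ^ k := fun i => by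
    simp [vertexRe, vertexEven, eval_finsetSum]
  have him : ∀ i, vertexIm d lo hi i ω = ω * ∑ k ∈ Finset.range ((d + 1) / 2),
      vertexCoeff lo hi i k (2 * k + 1) * (-ω ^ 2) ^ k := fun i => by
    simp [vertexIm, vertexOdd, eval_finsetSum]
  refine ⟨∑ k ∈ Finset.range (d / 2 + 1), c (2 * k) * (-ω ^ 2) ^ k, ?_,
    ω * ∑ k ∈ Finset.range ((d + 1) / 2), c (2 * k + 1) * (-ω ^ 2) ^ k, ?_, ?_⟩
  · rw [hre, hre]
    have h : ∀ k ∈ Finset.range (d / 2 + 1), c (2 * k) ∈ Set.Icc (lo (2 * k)) (hi (2 * k)) :=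
      fun k hk => hc _ (by have := Finset.mem_range.1 hk; omega)
    exact ⟨Finset.sum_le_sum fun k hk => (vertexCoeff_mul_neg_pow_le (h k hk)).1,
      Finset.sum_le_sum fun k hk => (vertexCoeff_mul_neg_pow_le (h k hk)).2⟩
  · rw [him, him]
    have h : ∀ k ∈ Finset.range ((d + 1) / 2),
        c (2 * k + 1) ∈ Set.Icc (lo (2 * k + 1)) (hi (2 * k + 1)) :=
      fun k hk => hc _ (by have := Finset.mem_range.1 hk; omega)
    exact ⟨mul_le_mul_of_nonneg_left
        (Finset.sum_le_sum fun k hk => (vertexCoeff_mul_neg_pow_le (h k hk)).1) hω,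
      mul_le_mul_of_nonneg_left
        (Finset.sum_le_sum fun k hk => (vertexCoeff_mul_neg_pow_le (h k hk)).2) hω⟩
  · have hsq : ((ω : ℂ) * Complex.I) ^ 2 = -(ω : ℂ) ^ 2 := by
      rw [mul_pow, Complex.I_sq]
      ring
    rw [sum_range_even_add_odd]
    simp only [Polynomial.map_add, Polynomial.map_sum, Polynomial.map_mul, Polynomial.map_C,
      Polynomial.map_pow, Polynomial.map_X, eval_add, eval_finsetSum, eval_mul, eval_C, eval_pow,
      eval_X, pow_succ _ (2 * _), pow_mul _ 2, hsq]
    push_cast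
    rw [mul_assoc, mul_comm (∑ _ ∈ _, _) Complex.I, ← mul_assoc, Finset.mul_sum]
    congr 1
    refine Finset.sum_congr rfl fun k _ => ?_
    simp only [Complex.coe_algebraMap]
    ring

/-! ### Interval families, the index set and gain bounds -/

section Family

variable {d : ℕ} {lo hi : ℕ → ℝ} {p q : ℝ[X]}

theorem natDegree_le_of_mem_intervalFamily (hp : p ∈ intervalFamily d lo hi) :
    p.natDegree ≤ d := by
  obtain ⟨c, -, rfl⟩ := hp
  refine natDegree_sum_le_of_forall_le _ _ fun i hi => ?_
  exact (natDegree_C_mul_X_pow_le _ _).trans (by have := Finset.mem_range.1 hi; omega)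

theorem coeff_mem_of_mem_intervalFamily (hp : p ∈ intervalFamily d lo hi) :
    p.coeff d ∈ Set.Icc (lo d) (hi d) := by
  obtain ⟨c, hc, rfl⟩ := hp
  simpa [finsetSum_coeff, coeff_C_mul, coeff_X_pow] using hc d le_rfl

theorem add_smul_sub_mem_intervalFamily (hp : p ∈ intervalFamily d lo hi)
    (hq : q ∈ intervalFamily d lo hi) {t : ℝ} (ht : t ∈ Set.Icc (0 : ℝ) 1) :
    p + C t * (q - p) ∈ intervalFamily d lo hi := by
  obtain ⟨c, hc, rfl⟩ := hp
  obtain ⟨c', hc', rfl⟩ := hq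
  refine ⟨fun i => c i + t * (c' i - c i), fun i hi => ?_, ?_⟩
  · have h := (convex_Icc (lo i) (_)).add_smul_sub_mem (hc i hi) (hc' i hi) ht
    simpa using h
  · rw [← Finset.sum_sub_distrib, Finset.mul_sum, ← Finset.sum_add_distrib]
    refine Finset.sum_congr rfl fun i _ => ?_
    simp only [C_add, C_mul, C_sub]
    ring

end Family

/-- Of the sixteen quadruples only the four that differ in both places are missing. This is the form
that the supporting-face argument produces. -/
theorem mem_twelveIndices_iff {i₁ j₁ i₂ j₂ : ℕ} : (i₁, j₁, i₂, j₂) ∈ twelveIndices ↔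
    (i₁ ∈ ({1, 2} : Set ℕ) ∧ j₁ ∈ ({1, 2} : Set ℕ) ∧ i₂ ∈ ({1, 2} : Set ℕ) ∧
      j₂ ∈ ({1, 2} : Set ℕ)) ∧ (i₁ = i₂ ∨ j₁ = j₂) := by
  simp only [twelveIndices, Set.mem_insert_iff, Set.mem_singleton_iff, Prod.mk.injEq]
  constructor
  · omega
  · rintro ⟨⟨rfl | rfl, rfl | rfl, rfl | rfl, rfl | rfl⟩, h⟩ <;> simp_all

theorem natDegree_C_mul_add_eq {f g : ℂ[X]} {n : ℕ} {z : ℂ} (hz : z ≠ 0) (hf : f.natDegree ≤ n)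
    (hfn : f.coeff n ≠ 0) (hg : g.natDegree < n) : (C z * f + g).natDegree = n := by
  refine natDegree_eq_of_le_of_coeff_ne_zero ?_ ?_
  · exact (natDegree_add_le _ _).trans (max_le ((natDegree_C_mul_le _ _).trans hf) hg.le)
  · simp [coeff_eq_zero_of_natDegree_lt hg, hz, hfn]

theorem IsHurwitz.freqGains_bddAbove {p q : ℝ[X]} (hq : IsHurwitz q)
    (hpq : p.natDegree ≤ q.natDegree) : BddAbove (freqGains p q) := by
  rw [isHurwitz_iff_map] at hq
  obtain ⟨K, hK, h⟩ := hq.exists_norm_eval_le (q := p.map (algebraMap ℝ ℂ))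
    (by simpa using hpq)
  refine ⟨K, ?_⟩
  rintro _ ⟨ω, rfl⟩
  have hre : 0 ≤ ((ω : ℂ) * Complex.I).re := by simp
  have h1 := h _ hre
  have h2 := norm_pos_iff.2 (hq.eval_ne_zero hre)
  rw [eval_map_algebraMap, eval_map_algebraMap] at h1
  rw [eval_map_algebraMap] at h2
  simp only [norm_div]
  rwa [div_le_iff₀ h2]

theorem IsHurwitz.norm_aeval_le_hInfNorm_mul {p q : ℝ[X]} (hq : IsHurwitz q)
    (hpq : p.natDegree ≤ q.natDegree) (ω : ℝ) :
    ‖aeval ((ω : ℂ) * Complex.I) p‖ ≤ hInfNorm p q * ‖aeval ((ω : ℂ) * Complex.I) q‖ := by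
  have hne : aeval ((ω : ℂ) * Complex.I) q ≠ 0 := fun h => by
    have := hq _ h
    simp at this
  have h := le_csSup (hq.freqGains_bddAbove hpq) ⟨ω, rfl⟩
  simp only [norm_div] at h
  rw [div_le_iff₀ (norm_pos_iff.2 hne)] at h
  exact h

/-- A strictly proper perturbation of the denominator does not change the gain at infinite
frequency. -/
theorem one_le_of_norm_eval_le {p g : ℂ[X]} {n : ℕ} (hp : p.natDegree ≤ n) (hpn : p.coeff n ≠ 0)
    (hg : g.natDegree < n) {K : ℝ}
    (h : ∀ ω : ℝ, ‖p.eval ((ω : ℂ) * Complex.I)‖ ≤ K * ‖(p + g).eval ((ω : ℂ) * Complex.I)‖) :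
    1 ≤ K := by
  have hpg : (p + g).natDegree ≤ n := (natDegree_add_le _ _).trans (max_le hp hg.le)
  have hlim : Filter.Tendsto (fun ω : ℝ => ((ω : ℂ) * Complex.I)⁻¹) Filter.atTop (nhds 0) := by
    rw [tendsto_zero_iff_norm_tendsto_zero]
    simpa [Function.comp_def] using
      (tendsto_inv_atTop_zero (𝕜 := ℝ)).comp Filter.tendsto_abs_atTop_atTop
  -- Since `q (iω) = (iω) ^ n * (reflect n q) (1 / (iω))`, the limit at infinite frequency becomes
  -- continuity of the reflected polynomial at 0.
  have hcont : ∀ q : ℂ[X], Filter.Tendsto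
      (fun ω : ℝ => ‖(reflect n q).eval ((ω : ℂ) * Complex.I)⁻¹‖) Filter.atTop
      (nhds ‖q.coeff n‖) := by
    intro q
    have h0 : (reflect n q).eval 0 = q.coeff n := by
      rw [← coeff_zero_eq_eval_zero, coeff_reflect, revAt_zero]
    rw [← h0]
    exact ((reflect n q).continuous.tendsto 0).comp hlim |>.norm
  have hle : ‖p.coeff n‖ ≤ K * ‖(p + g).coeff n‖ := by
    refine le_of_tendsto_of_tendsto (hcont p) ((hcont (p + g)).const_mul K) ?_
    filter_upwards [Filter.eventually_gt_atTop 0] with ω hω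
    have hne : (ω : ℂ) * Complex.I ≠ 0 := by simp [hω.ne']
    have hrefl : ∀ q : ℂ[X], q.natDegree ≤ n → ‖(reflect n q).eval ((ω : ℂ) * Complex.I)⁻¹‖
        * ω ^ n = ‖q.eval ((ω : ℂ) * Complex.I)‖ := by
      intro q hq
      let _ := invertibleOfNonzero hne
      have := eval₂_reflect_mul_pow (RingHom.id ℂ) ((ω : ℂ) * Complex.I) n q hq
      rw [invOf_eq_inv] at this
      rw [eval, eval, ← this, norm_mul, norm_pow, norm_mul, Complex.norm_I, Complex.norm_real,
        Real.norm_of_nonneg hω.le, mul_one]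
    have h1 := h ω
    rw [← hrefl p hp, ← hrefl _ hpg, ← mul_assoc] at h1
    exact le_of_mul_le_mul_right h1 (by positivity)
  rw [coeff_add, coeff_eq_zero_of_natDegree_lt hg, add_zero] at hle
  have := norm_pos_iff.2 hpn
  nlinarith

/-! ### Robust stability and the vertex gain bound -/

section Plant

variable {m n : ℕ} {bLo bHi aLo aHi : ℕ → ℝ}

/-- Zero exclusion for the family `z f + g` with `f` and `g` in interval families. -/
theorem eval_C_mul_add_ne_zero (hmn : m < n) (hb : ∀ i ≤ m, bLo i ≤ bHi i)
    (ha : ∀ i ≤ n, aLo i ≤ aHi i) (hlead : (0 : ℝ) ∉ Set.Icc (aLo n) (aHi n))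
    (hH : ∀ i ∈ ({1, 2} : Set ℕ), ∀ j ∈ ({1, 2} : Set ℕ),
      IsHurwitz (kharitonovVertex m bLo bHi i j + kharitonovVertex n aLo aHi i j))
    {z : ℂ} (hz : 0 < z.re)
    (hT : ∀ i₁ j₁ i₂ j₂, (i₁, j₁, i₂, j₂) ∈ twelveIndices → (z = 1 → i₁ = i₂ ∧ j₁ = j₂) →
      IsHurwitzComplex (C z * (kharitonovVertex n aLo aHi i₂ j₂).map (algebraMap ℝ ℂ)
        + (kharitonovVertex m bLo bHi i₁ j₁).map (algebraMap ℝ ℂ)))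
    {f g : ℝ[X]} (hf : f ∈ intervalFamily n aLo aHi) (hg : g ∈ intervalFamily m bLo bHi)
    {ω : ℝ} (hω : 0 ≤ ω) :
    z * aeval ((ω : ℂ) * Complex.I) f + aeval ((ω : ℂ) * Complex.I) g ≠ 0 := by
  have hz0 : z ≠ 0 := by rintro rfl; simp at hz
  have hdeg : ∀ w : ℂ, w ≠ 0 → ∀ i j k l,
      0 < (C w * (kharitonovVertex n aLo aHi i j).map (algebraMap ℝ ℂ)
        + (kharitonovVertex m bLo bHi k l).map (algebraMap ℝ ℂ)).natDegree := by
    intro w hw i j k l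
    have hv := kharitonovVertex_mem_intervalFamily ha i j
    have hv' := kharitonovVertex_mem_intervalFamily hb k l
    rw [natDegree_C_mul_add_eq (n := n) hw]
    · omega
    · simpa using natDegree_le_of_mem_intervalFamily hv
    · have := coeff_mem_of_mem_intervalFamily hv
      rw [coeff_map]
      simp only [Complex.coe_algebraMap, ne_eq, Complex.ofReal_eq_zero]
      intro h
      exact hlead (h ▸ this)
    · simpa using (natDegree_le_of_mem_intervalFamily hv').trans_lt hmn
  obtain ⟨x₁, hx₁, y₁, hy₁, e₁⟩ := exists_eval_eq_of_mem_intervalFamily hf hω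
  obtain ⟨x₂, hx₂, y₂, hy₂, e₂⟩ := exists_eval_eq_of_mem_intervalFamily hg hω
  have hle : ∀ {d lo hi}, (∀ i ≤ d, lo i ≤ hi i) → ∀ ω, 0 ≤ ω →
      vertexRe d lo hi 1 ω ≤ vertexRe d lo hi 2 ω ∧
        vertexIm d lo hi 1 ω ≤ vertexIm d lo hi 2 ω := by
    intro d lo hi h ω hω
    obtain ⟨x, hx, y, hy, -⟩ := exists_eval_eq_of_mem_intervalFamily
      (kharitonovVertex_mem_intervalFamily h 1 1) hω
    exact ⟨hx.1.trans hx.2, hy.1.trans hy.2⟩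
  have key := combinedValue_ne_zero hz
    (F := fun i j => (kharitonovVertex n aLo aHi i j).map (algebraMap ℝ ℂ))
    (G := fun i j => (kharitonovVertex m bLo bHi i j).map (algebraMap ℝ ℂ))
    (eval_map_kharitonovVertex n aLo aHi) (eval_map_kharitonovVertex m bLo bHi)
    (continuous_vertexRe n aLo aHi) (continuous_vertexIm n aLo aHi)
    (continuous_vertexRe m bLo bHi) (continuous_vertexIm m bLo bHi)
    (fun ω h => (hle ha ω h).1) (fun ω h => (hle ha ω h).2)
    (fun ω h => (hle hb ω h).1) (fun ω h => (hle hb ω h).2)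
    (by simp [vertexIm]) (by simp [vertexIm])
    (fun i hi j hj => ⟨by
        rw [← Polynomial.map_add, ← isHurwitz_iff_map, add_comm]
        exact hH i hi j hj, by simpa using hdeg 1 one_ne_zero i j i j⟩)
    (fun i₁ h₁ j₁ h₂ i₂ h₃ j₂ h₄ h hone =>
      ⟨hT i₁ j₁ i₂ j₂ (mem_twelveIndices_iff.2 ⟨⟨h₁, h₂, h₃, h₄⟩, h⟩) hone, hdeg z hz0 _ _ _ _⟩)
    hω (v := ((x₁, y₁), (x₂, y₂))) ⟨⟨hx₁, hy₁⟩, ⟨hx₂, hy₂⟩⟩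
  rw [← eval_map_algebraMap, ← eval_map_algebraMap, e₁, e₂]
  exact key

theorem aeval_neg_mul_I (p : ℝ[X]) (ω : ℝ) :
    aeval (((-ω : ℝ) : ℂ) * Complex.I) p
      = (starRingEnd ℂ) (aeval ((ω : ℂ) * Complex.I) p) := by
  rw [← aeval_conj]
  simp

/-- Kharitonov's theorem for the sum of two interval families. -/
theorem isHurwitz_add (hmn : m < n) (hb : ∀ i ≤ m, bLo i ≤ bHi i)
    (ha : ∀ i ≤ n, aLo i ≤ aHi i) (hlead : (0 : ℝ) ∉ Set.Icc (aLo n) (aHi n))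
    (hH : ∀ i ∈ ({1, 2} : Set ℕ), ∀ j ∈ ({1, 2} : Set ℕ),
      IsHurwitz (kharitonovVertex m bLo bHi i j + kharitonovVertex n aLo aHi i j))
    {f g : ℝ[X]} (hf : f ∈ intervalFamily n aLo aHi) (hg : g ∈ intervalFamily m bLo bHi) :
    IsHurwitz (f + g) := by
  have hpos : ∀ f ∈ intervalFamily n aLo aHi, ∀ g ∈ intervalFamily m bLo bHi, ∀ ω : ℝ, 0 ≤ ω →
      aeval ((ω : ℂ) * Complex.I) (f + g) ≠ 0 := by
    intro f hf g hg ω hω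
    have := eval_C_mul_add_ne_zero hmn hb ha hlead hH (z := 1) (by simp) (by
      intro i₁ j₁ i₂ j₂ h hone
      obtain ⟨rfl, rfl⟩ := hone rfl
      have h' := (mem_twelveIndices_iff.1 h).1
      have := (isHurwitz_iff_map _).1 (hH i₁ h'.1 j₁ h'.2.1)
      rw [Polynomial.map_add, add_comm] at this
      simpa using this) hf hg hω
    simpa using this
  have haxis : ∀ f ∈ intervalFamily n aLo aHi, ∀ g ∈ intervalFamily m bLo bHi, ∀ ω : ℝ,
      aeval ((ω : ℂ) * Complex.I) (f + g) ≠ 0 := by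
    intro f hf g hg ω
    rcases le_total 0 ω with h | h
    · exact hpos f hf g hg ω h
    · have := hpos f hf g hg (-ω) (by linarith)
      rw [aeval_neg_mul_I] at this
      simpa only [ne_eq, map_eq_zero] using this
  have hF := kharitonovVertex_mem_intervalFamily ha 1 1
  have hG := kharitonovVertex_mem_intervalFamily hb 1 1
  have h11 := hH 1 (by simp) 1 (by simp)
  rw [add_comm] at h11
  generalize kharitonovVertex n aLo aHi 1 1 = F at *
  generalize kharitonovVertex m bLo bHi 1 1 = G at *
  have hseg : ∀ t : ℝ, (F + G).map (algebraMap ℝ ℂ)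
      + C (t : ℂ) * ((f + g) - (F + G)).map (algebraMap ℝ ℂ)
      = ((F + C t * (f - F)) + (G + C t * (g - G))).map (algebraMap ℝ ℂ) := by
    intro t
    simp only [Polynomial.map_add, Polynomial.map_mul, Polynomial.map_sub, Polynomial.map_C,
      Complex.coe_algebraMap]
    ring
  -- The segment from the stable vertex sum stays in the convex families: the degree is constantly
  -- `n`, and `haxis` applies throughout.
  have := ((isHurwitz_iff_map _).1 h11).add_of_segment
    (q := ((f + g) - (F + G)).map (algebraMap ℝ ℂ)) (n := n)
    (fun t ht => by
      have hf' := add_smul_sub_mem_intervalFamily hF hf ht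
      have hg' := add_smul_sub_mem_intervalFamily hG hg ht
      rw [hseg, natDegree_map]
      refine natDegree_eq_of_le_of_coeff_ne_zero ?_ ?_
      · exact (natDegree_add_le _ _).trans (max_le (natDegree_le_of_mem_intervalFamily hf')
          ((natDegree_le_of_mem_intervalFamily hg').trans hmn.le))
      · rw [coeff_add, coeff_eq_zero_of_natDegree_lt
          ((natDegree_le_of_mem_intervalFamily hg').trans_lt hmn), add_zero]
        exact fun h => hlead (h ▸ coeff_mem_of_mem_intervalFamily hf'))
    (fun t ht ω => by
      rw [hseg, eval_map_algebraMap]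
      exact haxis _ (add_smul_sub_mem_intervalFamily hF hf ht) _
        (add_smul_sub_mem_intervalFamily hG hg ht) ω)
  rw [isHurwitz_iff_map]
  rwa [← Polynomial.map_add, add_sub_cancel] at this

theorem natDegree_of_mem_intervalFamily (hlead : (0 : ℝ) ∉ Set.Icc (aLo n) (aHi n)) {f : ℝ[X]}
    (hf : f ∈ intervalFamily n aLo aHi) : f.natDegree = n :=
  natDegree_eq_of_le_of_coeff_ne_zero (natDegree_le_of_mem_intervalFamily hf)
    fun h => hlead (h ▸ coeff_mem_of_mem_intervalFamily hf)

theorem natDegree_add_of_mem_intervalFamily (hmn : m < n)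
    (hlead : (0 : ℝ) ∉ Set.Icc (aLo n) (aHi n)) {f g : ℝ[X]}
    (hf : f ∈ intervalFamily n aLo aHi) (hg : g ∈ intervalFamily m bLo bHi) :
    (f + g).natDegree = n := by
  have h := natDegree_of_mem_intervalFamily hlead hf
  rw [natDegree_add_eq_left_of_natDegree_lt, h]
  rw [h]
  exact (natDegree_le_of_mem_intervalFamily hg).trans_lt hmn

/-- A common gain bound for the twelve vertex systems holds for the whole family. -/
theorem norm_aeval_le_of_vertices (hmn : m < n) (hb : ∀ i ≤ m, bLo i ≤ bHi i)
    (ha : ∀ i ≤ n, aLo i ≤ aHi i) (hlead : (0 : ℝ) ∉ Set.Icc (aLo n) (aHi n))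
    (hH : ∀ i ∈ ({1, 2} : Set ℕ), ∀ j ∈ ({1, 2} : Set ℕ),
      IsHurwitz (kharitonovVertex m bLo bHi i j + kharitonovVertex n aLo aHi i j))
    {K : ℝ} (hK : ∀ i₁ j₁ i₂ j₂, (i₁, j₁, i₂, j₂) ∈ twelveIndices → ∀ ω : ℝ,
      ‖aeval ((ω : ℂ) * Complex.I) (kharitonovVertex n aLo aHi i₂ j₂)‖
        ≤ K * ‖aeval ((ω : ℂ) * Complex.I)
          (kharitonovVertex n aLo aHi i₂ j₂ + kharitonovVertex m bLo bHi i₁ j₁)‖)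
    {f g : ℝ[X]} (hf : f ∈ intervalFamily n aLo aHi) (hg : g ∈ intervalFamily m bLo bHi) (ω : ℝ) :
    ‖aeval ((ω : ℂ) * Complex.I) f‖ ≤ K * ‖aeval ((ω : ℂ) * Complex.I) (f + g)‖ := by
  have hmapdeg : ∀ i j, ((kharitonovVertex n aLo aHi i j).map (algebraMap ℝ ℂ)).natDegree ≤ n :=
    fun i j => by
      simpa using natDegree_le_of_mem_intervalFamily (kharitonovVertex_mem_intervalFamily ha i j)
  have hmapdeg' : ∀ i j, ((kharitonovVertex m bLo bHi i j).map (algebraMap ℝ ℂ)).natDegree < n :=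
    fun i j => by
      simpa using (natDegree_le_of_mem_intervalFamily
        (kharitonovVertex_mem_intervalFamily hb i j)).trans_lt hmn
  have hmapcoeff : ∀ i j, ((kharitonovVertex n aLo aHi i j).map (algebraMap ℝ ℂ)).coeff n ≠ 0 :=
    fun i j => by
      have := coeff_mem_of_mem_intervalFamily (kharitonovVertex_mem_intervalFamily ha i j)
      rw [coeff_map]
      simp only [Complex.coe_algebraMap, ne_eq, Complex.ofReal_eq_zero]
      intro h
      exact hlead (h ▸ this)
  have hK1 : 1 ≤ K := by
    refine one_le_of_norm_eval_le (hmapdeg 1 1) (hmapcoeff 1 1) (hmapdeg' 1 1) fun ω => ?_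
    rw [← Polynomial.map_add, eval_map_algebraMap, eval_map_algebraMap]
    exact hK 1 1 1 1 (by simp [twelveIndices]) ω
  have hpos : ∀ ω : ℝ, 0 ≤ ω →
      ‖aeval ((ω : ℂ) * Complex.I) f‖ ≤ K * ‖aeval ((ω : ℂ) * Complex.I) (f + g)‖ := by
    intro ω hω
    by_contra! hlt
    set u := aeval ((ω : ℂ) * Complex.I) f with hu
    set w := aeval ((ω : ℂ) * Complex.I) (f + g) with hw
    have hu0 : 0 < ‖u‖ := lt_of_le_of_lt (by positivity) hlt
    have hune : u ≠ 0 := norm_pos_iff.1 hu0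
    -- The perturbation for which `(1 + ζ) f + g` vanishes at `iω`.
    let ζ : ℂ := -(w / u)
    have hζK : ‖ζ‖ * K < 1 := by
      simp only [ζ, norm_neg, norm_div]
      rw [div_mul_eq_mul_div, div_lt_one hu0, mul_comm]
      exact hlt
    have hζ : ‖ζ‖ < 1 := by nlinarith [norm_nonneg ζ]
    have hone : ∀ t ∈ Set.Icc (0 : ℝ) 1, 0 < (1 + (t : ℂ) * ζ).re := by
      intro t ht
      have h1 := (abs_le.1 (Complex.abs_re_le_norm ζ)).1
      have h2 : t * -ζ.re ≤ t * ‖ζ‖ := mul_le_mul_of_nonneg_left (by linarith) ht.1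
      have h3 : t * ‖ζ‖ ≤ 1 * ‖ζ‖ := mul_le_mul_of_nonneg_right ht.2 (norm_nonneg _)
      simp only [Complex.add_re, Complex.one_re, Complex.re_ofReal_mul]
      linarith
    refine eval_C_mul_add_ne_zero hmn hb ha hlead hH (z := 1 + ζ)
      (by simpa using hone 1 (by simp)) ?_ hf hg hω ?_
    · intro i₁ j₁ i₂ j₂ hmem _
      have hst := isHurwitz_add hmn hb ha hlead hH (kharitonovVertex_mem_intervalFamily ha i₂ j₂)
        (kharitonovVertex_mem_intervalFamily hb i₁ j₁)
      have hgain := hK i₁ j₁ i₂ j₂ hmem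
      rw [isHurwitz_iff_map] at hst
      simp only [← eval_map_algebraMap] at hgain
      have hd := hmapdeg i₂ j₂
      have hd' := hmapdeg' i₁ j₁
      have hc := hmapcoeff i₂ j₂
      rw [Polynomial.map_add] at hst
      simp only [Polynomial.map_add] at hgain
      generalize (kharitonovVertex n aLo aHi i₂ j₂).map (algebraMap ℝ ℂ) = F at *
      generalize (kharitonovVertex m bLo bHi i₁ j₁).map (algebraMap ℝ ℂ) = G at *
      have hseg : ∀ t : ℝ, F + G + C (t : ℂ) * (C ζ * F) = C (1 + (t : ℂ) * ζ) * F + G := by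
        intro t
        simp only [C_add, C_mul, C_1]
        ring
      -- Small gain: on the axis `|t ζ F| ≤ |ζ| K |F + G| < |F + G|`, so no root crosses. The
      -- leading coefficient survives because `Re (1 + t ζ) > 0`.
      have := hst.add_of_segment (q := C ζ * F) (n := n)
        (fun t ht => by
          rw [hseg]
          refine natDegree_C_mul_add_eq (fun h => ?_) hd hc hd'
          have := hone t ht
          simp [h] at this)
        (fun t ht x => by
          have h1 : 0 < ‖(F + G).eval ((x : ℂ) * Complex.I)‖ :=
            norm_pos_iff.2 (hst.eval_ne_zero (by simp))
          have h2 := hgain x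
          intro h0
          rw [eval_add, eval_mul, eval_C, eval_mul, eval_C, add_eq_zero_iff_eq_neg] at h0
          have h3 := congrArg norm h0
          rw [norm_neg, norm_mul, norm_mul, Complex.norm_real, Real.norm_of_nonneg ht.1] at h3
          have h4 : t * (‖ζ‖ * ‖F.eval ((x : ℂ) * Complex.I)‖)
              ≤ 1 * (‖ζ‖ * (K * ‖(F + G).eval ((x : ℂ) * Complex.I)‖)) := by
            gcongr
            exact ht.2
          nlinarith)
      have e : F + G + C ζ * F = C (1 + ζ) * F + G := by
        simpa using hseg 1
      rwa [e] at this
    · have hgw : aeval ((ω : ℂ) * Complex.I) g = w - u := by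
        rw [hw, hu, map_add]
        ring
      rw [hgw]
      simp only [ζ]
      field_simp
      ring
  -- Negative frequencies follow by conjugation, as `f` and `g` are real. The complex family `z f +
  -- g` has no such symmetry and is used only for `ω ≥ 0`.
  rcases le_total 0 ω with h | h
  · exact hpos ω h
  · have := hpos (-ω) (by linarith)
    simpa only [aeval_neg_mul_I, RCLike.norm_conj] using this

end Plant

/-! ### The main theorem -/

theorem theorem2p1 (m n : ℕ) (hmn : m < n) (bLo bHi aLo aHi : ℕ → ℝ)
    (hb : ∀ i ≤ m, bLo i ≤ bHi i) (ha : ∀ i ≤ n, aLo i ≤ aHi i)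
    (hlead : (0 : ℝ) ∉ Set.Icc (aLo n) (aHi n))
    (hH : ∀ i ∈ ({1, 2} : Set ℕ), ∀ j ∈ ({1, 2} : Set ℕ),
      IsHurwitz (kharitonovVertex m bLo bHi i j + kharitonovVertex n aLo aHi i j)) :
    (∀ g ∈ intervalFamily m bLo bHi, ∀ f ∈ intervalFamily n aLo aHi,
      IsProperStable f (f + g) ∧ BddAbove (freqGains f (f + g))) ∧
    ∃ M : ℝ,
      IsGreatest {x : ℝ | ∃ g ∈ intervalFamily m bLo bHi, ∃ f ∈ intervalFamily n aLo aHi,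
        x = hInfNorm f (f + g)} M ∧
      IsGreatest {x : ℝ | ∃ i₁ j₁ i₂ j₂ : ℕ, (i₁, j₁, i₂, j₂) ∈ twelveIndices ∧
        x = hInfNorm (kharitonovVertex n aLo aHi i₂ j₂)
          (kharitonovVertex n aLo aHi i₂ j₂ + kharitonovVertex m bLo bHi i₁ j₁)} M := by
  have hst : ∀ g ∈ intervalFamily m bLo bHi, ∀ f ∈ intervalFamily n aLo aHi, IsHurwitz (f + g) :=
    fun g hg f hf => isHurwitz_add hmn hb ha hlead hH hf hg
  have hdeg : ∀ g ∈ intervalFamily m bLo bHi, ∀ f ∈ intervalFamily n aLo aHi,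
      f.natDegree ≤ (f + g).natDegree := fun g hg f hf => by
    rw [natDegree_of_mem_intervalFamily hlead hf,
      natDegree_add_of_mem_intervalFamily hmn hlead hf hg]
  have hF := kharitonovVertex_mem_intervalFamily ha
  have hG := kharitonovVertex_mem_intervalFamily hb
  refine ⟨fun g hg f hf => ⟨⟨hst g hg f hf, ?_⟩,
    (hst g hg f hf).freqGains_bddAbove (hdeg g hg f hf)⟩, ?_⟩
  · have hne : f + g ≠ 0 := by
      intro h
      have := hst g hg f hf 0
      simp [h] at this
    rw [degree_eq_natDegree hne]
    exact degree_le_natDegree.trans (by exact_mod_cast hdeg g hg f hf)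
  obtain ⟨⟨i₁, j₁, i₂, j₂⟩, hmem, hmax⟩ := Set.exists_max_image twelveIndices
    (fun k => hInfNorm (kharitonovVertex n aLo aHi k.2.2.1 k.2.2.2)
      (kharitonovVertex n aLo aHi k.2.2.1 k.2.2.2 + kharitonovVertex m bLo bHi k.1 k.2.1))
    (by unfold twelveIndices; exact Set.toFinite _) ⟨(1, 1, 1, 1), by simp [twelveIndices]⟩
  -- The best of the twelve vertex systems belongs to the full family, so its norm is attained
  -- there; the upper bound takes this norm as `K`.
  refine ⟨_, ⟨⟨_, hG i₁ j₁, _, hF i₂ j₂, rfl⟩, ?_⟩, ⟨i₁, j₁, i₂, j₂, hmem, rfl⟩, ?_⟩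
  · rintro _ ⟨g, hg, f, hf, rfl⟩
    refine csSup_le (Set.range_nonempty _) ?_
    rintro _ ⟨ω, rfl⟩
    have hne : aeval ((ω : ℂ) * Complex.I) (f + g) ≠ 0 := fun h => by
      have := hst g hg f hf _ h
      simp at this
    simp only [norm_div]
    rw [div_le_iff₀ (norm_pos_iff.2 hne)]
    refine norm_aeval_le_of_vertices hmn hb ha hlead hH (fun k₁ l₁ k₂ l₂ hk ω => ?_) hf hg ω
    refine ((hst _ (hG k₁ l₁) _ (hF k₂ l₂)).norm_aeval_le_hInfNorm_mul
      (hdeg _ (hG k₁ l₁) _ (hF k₂ l₂)) ω).trans ?_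
    exact mul_le_mul_of_nonneg_right (hmax (k₁, l₁, k₂, l₂) hk) (norm_nonneg _)
  · rintro _ ⟨k₁, l₁, k₂, l₂, hk, rfl⟩
    exact hmax (k₁, l₁, k₂, l₂) hk
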